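/- Let $F$ be a field with $\operatorname{char}(F)\neq 2$ and let $A$ be a finite-dimensional associative algebra over $F$ (not assumed to be unital) that is semisimple, i.e., its radical (the unique maximal nilpotent two-sided ideal of $A$) is $\{0\}$. Let $[A,A]$ denote the $F$-linear span of all commutators $[x,y]=xy-yx$ with $x,y\in A$. Then the following two conditions are equivalent for an $F$-linear map $D:A\to A$: (i) $xD(x)x\in[A,A]$ for every $x\in A$; (ii) $D$ is an inner derivation, i.e., there exists $a\in A$ such that $D(x)=[a,x]$ for all $x\in A$. -/

import Mathlib

/-!
Algebras are associative and not assumed to have an identity element: an algebra over a field `F`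
is a `NonUnitalRing A` with a compatible `Module F A` structure.
-/

namespace FinDimAlg

section

variable (F : Type*) {A : Type*} [Field F] [NonUnitalRing A] [Module F A]

/-- The linear subspace `I` of `A` is a (two-sided) ideal. -/
def IsIdeal (I : Submodule F A) : Prop :=
  ∀ x ∈ I, ∀ a : A, a * x ∈ I ∧ x * a ∈ I

/-- `power F I n` is the linear span of all products of `n + 1` elements of `I`, so it is the
power of `I` with exponent `n + 1` (there is no zeroth power, since `A` need not be unital). -/
def power (I : Submodule F A) : ℕ → Submodule F A
  | 0 => I
  | n + 1 => Submodule.span F {z | ∃ x ∈ power I n, ∃ y ∈ I, z = x * y}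

/-- Some power of `I` with positive exponent is zero. -/
def IsNilpotentSubspace (I : Submodule F A) : Prop :=
  ∃ n : ℕ, power F I n = ⊥

variable (A) in
/-- The radical: the sum of all nilpotent ideals. When `A` is finite-dimensional this is the unique
maximal nilpotent ideal of `A`. -/
def radical : Submodule F A :=
  sSup {I : Submodule F A | IsIdeal F I ∧ IsNilpotentSubspace F I}

variable (A) in
/-- A (finite-dimensional) algebra is semisimple if its radical is zero. -/
def IsSemisimple : Prop :=
  radical F A = ⊥

variable (A) in
/-- `[A, A]`: the linear span of all commutators `[x, y] = x * y - y * x`. -/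
def commutatorSpan : Submodule F A :=
  Submodule.span F {c | ∃ x y : A, c = x * y - y * x}

/-- `D` is an inner derivation: `D x = [a, x]` for some fixed `a`. -/
def IsInnerDerivation (D : A →ₗ[F] A) : Prop :=
  ∃ a : A, ∀ x : A, D x = a * x - x * a

end

end FinDimAlg

/-! An inner derivation satisfies (i) because `x[a,x]x = [xax, x]`. For the converse, semisimplicity
gives an identity element (`exists_identity`), Wedderburn–Artin makes `A` a product of simple
algebras, and polarization shows that `D` respects the factors. It remains to treat one simple
algebra `R`.

Modulo `[R,R]` the pairing `(a, x) ↦ ax` is nondegenerate: its kernel is an ideal, and `R ≠ [R,R]`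
by a trace after extension of scalars. Polarizing the cubic condition and cancelling the free
variable therefore gives an identity in `R`: `2D(y²) = 2(D(y)y + yD(y)) - (cy² + y²c)` with `c =
D(1)`. It implies `(ad y)⁴ c = 0` for all `y`, which forces `c` to be central
(`commute_of_ad_four`).

Now `E(x) = D(x) - cx` is a Jordan derivation, hence a derivation by Herstein's theorem.
Nondegeneracy shows that it kills the center, so it is inner. Then `cx³ ∈ [R,R]` for all `x`; if `c
≠ 0` then `c` is invertible and every cube lies in `[R,R]`, which
`exists_cube_notMem_commutatorSpan` excludes. -/

namespace FinDimAlg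

/-! ### Jordan derivations and Herstein's theorem -/

section Jordan

variable {R : Type*} [Ring R]

/-- The defect `[[c, y], y]` of a map from being a Jordan derivation satisfies `(ad y)⁴ c = 0`. -/
theorem ad_four_eq_zero (E : R →+ R) (c : R)
    (hE : ∀ y, E (y * y) = E y * y + y * E y - (c * y * y - 2 * (y * c * y) + y * y * c)) (y : R) :
    c * y * y * y * y - 4 * (y * c * y * y * y) + 6 * (y * y * c * y * y) - 4 * (y * y * y * c * y)
      + y * y * y * y * c = 0 := by
  have lin : ∀ x y, E (x * y) + E (y * x) = E x * y + x * E y + E y * x + y * E x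
      - ((c * x - x * c) * y - y * (c * x - x * c) + (c * y - y * c) * x - x * (c * y - y * c)) := by
    intro x y
    have h := hE (x + y)
    have e : (x + y) * (x + y) = x * x + x * y + y * x + y * y := by noncomm_ring
    rw [e] at h
    simp only [map_add] at h
    linear_combination (norm := noncomm_ring) h - hE x - hE y
  -- Two expansions of `E(y⁴)` are compared: from `y² · y²`, and from `y · y³` with `E(y³)` itself
  -- expanded.
  have h2 := hE y
  have h3 := lin y (y * y)
  have h4 := lin y (y * (y * y))
  have h4' := hE (y * y)
  rw [mul_assoc y y y] at h3
  rw [show y * (y * y) * y = y * y * (y * y) by noncomm_ring,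
    show y * (y * (y * y)) = y * y * (y * y) by noncomm_ring, h4', h2] at h4
  rw [h2] at h3
  linear_combination (norm := noncomm_ring) -(2 * h4 + y * h3 + h3 * y)

/-- In a prime ring without `2`-torsion, `a z b + b z a = 0` for all `z` forces `a = 0` or
`b = 0`. -/
theorem eq_zero_or_eq_zero_of_mul_mul_add (h2 : ∀ x : R, x + x = 0 → x = 0)
    (hp : ∀ a b : R, (∀ z, a * z * b = 0) → a = 0 ∨ b = 0) {a b : R}
    (h : ∀ z, a * z * b + b * z * a = 0) : a = 0 ∨ b = 0 := by
  apply hp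
  intro z
  -- Three uses of the sign rule `a z b = -(b z a)` bring the product back to its own negative.
  have key : ∀ w, a * z * b * w * (a * z * b) = 0 := by
    intro w
    apply h2
    linear_combination (norm := noncomm_ring)
      a * z * h w * z * b - h (z * a * w) * z * b + h z * w * (a * z * b)
  have := hp _ _ key
  tauto

/-- Herstein's theorem: a Jordan derivation of a prime ring without `2`-torsion is a derivation. -/
theorem derivation_of_jordan (h2 : ∀ x : R, x + x = 0 → x = 0)
    (hp : ∀ a b : R, (∀ z, a * z * b = 0) → a = 0 ∨ b = 0) (E : R →+ R)
    (hE : ∀ y, E (y * y) = E y * y + y * E y) (x y : R) : E (x * y) = E x * y + x * E y := by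
  have lin : ∀ x y, E (x * y) + E (y * x) = E x * y + x * E y + E y * x + y * E x := by
    intro x y
    have h := hE (x + y)
    have e : (x + y) * (x + y) = x * x + x * y + y * x + y * y := by noncomm_ring
    rw [e] at h
    simp only [map_add] at h
    linear_combination (norm := noncomm_ring) h - hE x - hE y
  have tri : ∀ x y, E (x * y * x) = E x * y * x + x * E y * x + x * y * E x := by
    intro x y
    have h1 := lin x (x * y + y * x)
    have h3 := lin (x * x) y
    have l := lin x y
    have q := hE x
    rw [show x * (x * y + y * x) = x * x * y + x * y * x by noncomm_ring,
      show (x * y + y * x) * x = x * y * x + y * (x * x) by noncomm_ring] at h1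
    simp only [map_add] at h1
    rw [l] at h1
    rw [q] at h3
    rw [← sub_eq_zero]
    apply h2
    linear_combination (norm := noncomm_ring) h1 - h3
  have trilin : ∀ x y z, E (x * y * z) + E (z * y * x) = E x * y * z + x * E y * z + x * y * E z
      + E z * y * x + z * E y * x + z * y * E x := by
    intro x y z
    have h := tri (x + z) y
    rw [show (x + z) * y * (x + z) = x * y * x + x * y * z + z * y * x + z * y * z by
      noncomm_ring] at h
    simp only [map_add] at h
    linear_combination (norm := noncomm_ring) h - tri x y - tri z y
  have key : ∀ x y, E (x * y) - E x * y - x * E y = 0 ∨ x * y - y * x = 0 := by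
    intro x y
    apply eq_zero_or_eq_zero_of_mul_mul_add h2 hp
    intro z
    -- `E(xyzyx + yxzxy)` is computed from the outer factors `xy`, `yx` and again as nested triple
    -- products.
    have h := trilin (x * y) z (y * x)
    have ha := tri x (y * z * y)
    have hb := tri y (x * z * x)
    rw [tri y z] at ha
    rw [tri x z] at hb
    rw [show x * y * z * (y * x) = x * (y * z * y) * x by noncomm_ring,
      show y * x * z * (x * y) = y * (x * z * x) * y by noncomm_ring] at h
    have l := lin x y
    linear_combination (norm := noncomm_ring) h - ha - hb + x * y * z * l + l * z * (x * y)
  -- For fixed `x` both alternatives in `key` are additive in `y`, and a group is not the union of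
  -- two proper subgroups.
  have nc : ∀ x, (∃ w, x * w - w * x ≠ 0) → ∀ y, E (x * y) - E x * y - x * E y = 0 := by
    rintro x ⟨w, hw⟩ y
    rcases key x y with h | h
    · exact h
    · have hw' := (key x w).resolve_right hw
      have := key x (y + w)
      rw [mul_add, add_mul, map_add, map_add] at this
      rcases this with h' | h'
      · linear_combination (norm := noncomm_ring) h' - hw'
      · exact absurd (by linear_combination (norm := noncomm_ring) h' - h) hw
  rw [← sub_eq_zero, ← sub_sub]
  by_cases hc : ∃ u w : R, u * w - w * u ≠ 0
  · obtain ⟨u, w, huw⟩ := hc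
    by_cases hx : ∃ w, x * w - w * x ≠ 0
    · exact nc x hx y
    · push Not at hx
      have h1 := nc u ⟨w, huw⟩ y
      have h3 := nc (x + u) ⟨w, by
        intro h
        exact huw (by linear_combination (norm := noncomm_ring) h - hx w)⟩ y
      rw [add_mul, map_add, map_add] at h3
      linear_combination (norm := noncomm_ring) h3 - h1
  · push Not at hc
    apply h2
    have hxy := hc x y
    have l := lin x y
    rw [← sub_eq_zero.1 hxy] at l
    linear_combination (norm := noncomm_ring) l - hc (E x) y - hc x (E y)

end Jordan

/-! ### Simple rings and idempotents -/

section Simple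

variable {R : Type*} [Ring R]

/-- A subset of a simple ring with the closure properties of an ideal and a nonzero element contains
everything. -/
theorem mem_of_isSimpleRing [IsSimpleRing R] (s : Set R) (zero_mem : 0 ∈ s)
    (add_mem : ∀ {x y}, x ∈ s → y ∈ s → x + y ∈ s)
    (mul_mem_left : ∀ {x y}, y ∈ s → x * y ∈ s)
    (mul_mem_right : ∀ {x y}, x ∈ s → x * y ∈ s) {x : R} (hx : x ∈ s) (hx0 : x ≠ 0) (y : R) :
    y ∈ s := by
  let I : TwoSidedIdeal R := TwoSidedIdeal.mk' s zero_mem add_mem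
    (fun {x} h => by simpa using mul_mem_left (x := -1) h) mul_mem_left mul_mem_right
  have h1 : (1 : R) ∈ I := IsSimpleRing.one_mem_of_ne_zero_mem I hx0
    ((TwoSidedIdeal.mem_mk' ..).2 hx)
  have := mul_mem_left (x := y) ((TwoSidedIdeal.mem_mk' ..).1 h1)
  simpa using this

/-- Simple rings are prime. -/
theorem eq_zero_or_eq_zero_of_forall_mul_mul [IsSimpleRing R] (a b : R)
    (h : ∀ z, a * z * b = 0) : a = 0 ∨ b = 0 := by
  by_contra! hab
  have := mem_of_isSimpleRing {r : R | ∀ z, a * z * r = 0} (by simp)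
    (fun hx hy z => by rw [mul_add, hx z, hy z, add_zero])
    (fun {x y} hy z => by rw [← mul_assoc, mul_assoc a, hy])
    (fun {x y} hx z => by rw [← mul_assoc, hx, zero_mul]) h hab.2 1 1
  simp_all

/-- In a simple ring with a nontrivial idempotent an element commuting with all idempotents is
central. -/
theorem commute_of_commute_idempotents [IsSimpleRing R] {c e : R} (he : e * e = e) (he0 : e ≠ 0)
    (he1 : e ≠ 1) (hc : ∀ f : R, f * f = f → c * f = f * c) (x : R) : c * x = x * c := by
  have corner : ∀ e : R, e * e = e → ∀ x, c * (e * x * (1 - e)) = e * x * (1 - e) * c := by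
    intro e he x
    have h1 := hc e he
    have h2 := hc (e + e * x * (1 - e)) (by
      have h3 : (1 - e) * e = 0 := by rw [sub_mul, one_mul, he, sub_self]
      calc (e + e * x * (1 - e)) * (e + e * x * (1 - e))
          = e * e + e * e * x * (1 - e) + e * x * ((1 - e) * e)
            + e * x * ((1 - e) * e) * x * (1 - e) := by noncomm_ring
        _ = _ := by rw [h3, he]; noncomm_ring)
    linear_combination (norm := noncomm_ring) h2 - h1
  have diag : ∀ e : R, e * e = e → e ≠ 1 → ∀ x, c * (e * x * e) = e * x * e * c := by
    intro e he he1 x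
    have he' : (1 - e) * (1 - e) = 1 - e := by
      rw [mul_sub, sub_mul, sub_mul, he]; noncomm_ring
    -- A product `e a (1 - e) b e` of two corner elements commutes with `c`. Since `1 - e ≠ 0`
    -- generates `R` as an ideal, it may be replaced by `1`.
    have := mem_of_isSimpleRing
      {r : R | ∀ a b, c * (e * a * r * (b * e)) = e * a * r * (b * e) * c} (by simp)
      (fun {x y} hx hy a b => by
        linear_combination (norm := noncomm_ring) hx a b + hy a b)
      (fun {x y} hy a b => by
        linear_combination (norm := noncomm_ring) hy (a * x) b)
      (fun {x y} hx a b => by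
        linear_combination (norm := noncomm_ring) hx a (y * b))
      (x := 1 - e) (by
        intro a b
        have h1 := corner e he a
        have h2 := corner (1 - e) he' b
        rw [sub_sub_cancel] at h2
        have h3 : e * a * (1 - e) * (b * e) = e * a * (1 - e) * ((1 - e) * b * e) := by
          calc _ = e * a * ((1 - e) * (1 - e)) * (b * e) := by rw [he']
            _ = _ := by simp only [mul_assoc]
        rw [h3]
        linear_combination (norm := noncomm_ring)
          h1 * ((1 - e) * b * e) + e * a * (1 - e) * h2)
      (sub_ne_zero.2 he1.symm) 1 x 1
    simpa using this
  have he' : (1 - e) * (1 - e) = 1 - e := by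
    rw [mul_sub, sub_mul, sub_mul, he]; noncomm_ring
  have h1 := diag e he he1 x
  have h2 := diag (1 - e) he' (by simpa using he0) x
  have h3 := corner e he x
  have h4 := corner (1 - e) he' x
  linear_combination (norm := noncomm_ring) h1 + h2 + h3 + h4

/-- An idempotent annihilating `c` under the fourth power of its inner derivation commutes
with `c`. -/
theorem commute_idempotent_of_ad_four {c e : R} (he : e * e = e)
    (h : c * e * e * e * e - 4 * (e * c * e * e * e) + 6 * (e * e * c * e * e)
      - 4 * (e * e * e * c * e) + e * e * e * e * c = 0) : c * e = e * c := by
  -- For an idempotent, `(ad e)⁴ = (ad e)²`.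
  have h' : c * e - 2 * (e * c * e) + e * c = 0 := by
    simp only [mul_assoc, he] at h
    simp only [← mul_assoc] at h
    linear_combination (norm := noncomm_ring) h
  have h1 := congrArg (fun u => e * u) h'
  have h2 := congrArg (fun u => u * e) h'
  have e1 : e * (c * e - 2 * (e * c * e) + e * c) = e * c - e * c * e := by
    calc _ = e * c * e - 2 * (e * e * c * e) + e * e * c := by noncomm_ring
      _ = _ := by rw [he]; noncomm_ring
  have e2 : (c * e - 2 * (e * c * e) + e * c) * e = c * e - e * c * e := by
    calc _ = c * (e * e) - 2 * (e * c * (e * e)) + e * c * e := by noncomm_ring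
      _ = _ := by rw [he]; noncomm_ring
  simp only [e1, e2, mul_zero, zero_mul] at h1 h2
  linear_combination (norm := noncomm_ring) h2 - h1

end Simple

/-! ### Division algebras: the Lie ideal argument -/

section Division

attribute [local instance] LieRing.ofAssociativeRing

/-- A quartic polynomial expression vanishing on an infinite field has zero linear coefficient. -/
theorem coeff_one_eq_zero {F V : Type*} [Field F] [Infinite F] [AddCommGroup V] [Module F V]
    (p₀ p₁ p₂ p₃ p₄ : V)
    (h : ∀ l : F, p₀ + l • p₁ + l ^ 2 • p₂ + l ^ 3 • p₃ + l ^ 4 • p₄ = 0) : p₁ = 0 := by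
  rw [← Module.forall_dual_apply_eq_zero_iff F]
  intro φ
  have hp : (Polynomial.C (φ p₀) + Polynomial.C (φ p₁) * Polynomial.X
      + Polynomial.C (φ p₂) * Polynomial.X ^ 2 + Polynomial.C (φ p₃) * Polynomial.X ^ 3
      + Polynomial.C (φ p₄) * Polynomial.X ^ 4 : Polynomial F) = 0 := by
    apply Polynomial.funext
    intro l
    have := congrArg φ (h l)
    simp only [map_add, map_smul, smul_eq_mul, map_zero] at this
    simp only [Polynomial.eval_add, Polynomial.eval_mul, Polynomial.eval_C, Polynomial.eval_X,
      Polynomial.eval_pow, Polynomial.eval_zero]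
    linear_combination this
  have := congrArg (Polynomial.coeff · 1) hp
  simpa [Polynomial.coeff_X, Polynomial.coeff_X_pow, Polynomial.coeff_C] using this

variable {F R : Type*} [Field F] [Ring R] [Algebra F R]

variable (F) in
/-- Over an infinite field, the elements killed by all fourth powers of inner derivations form a
Lie ideal. -/
theorem ad_four_lie_eq_zero [Infinite F] {c : R} (hc : ∀ y : R, ⁅y, ⁅y, ⁅y, ⁅y, c⁆⁆⁆⁆ = 0)
    (z y : R) : ⁅y, ⁅y, ⁅y, ⁅y, ⁅z, c⁆⁆⁆⁆⁆ = 0 := by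
  -- Applying `ad z` to `(ad y)⁴ c = 0` yields `(ad y)⁴ [z, c]` plus the coefficient of `l` in `(ad
  -- (y + l w))⁴ c`, which vanishes.
  set w := ⁅z, y⁆ with hw
  have h := coeff_one_eq_zero (F := F) ⁅y, ⁅y, ⁅y, ⁅y, c⁆⁆⁆⁆
    (⁅w, ⁅y, ⁅y, ⁅y, c⁆⁆⁆⁆ + ⁅y, ⁅w, ⁅y, ⁅y, c⁆⁆⁆⁆ + ⁅y, ⁅y, ⁅w, ⁅y, c⁆⁆⁆⁆ + ⁅y, ⁅y, ⁅y, ⁅w, c⁆⁆⁆⁆)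
    (⁅w, ⁅w, ⁅y, ⁅y, c⁆⁆⁆⁆ + ⁅w, ⁅y, ⁅w, ⁅y, c⁆⁆⁆⁆ + ⁅w, ⁅y, ⁅y, ⁅w, c⁆⁆⁆⁆ + ⁅y, ⁅w, ⁅w, ⁅y, c⁆⁆⁆⁆
      + ⁅y, ⁅w, ⁅y, ⁅w, c⁆⁆⁆⁆ + ⁅y, ⁅y, ⁅w, ⁅w, c⁆⁆⁆⁆)
    (⁅y, ⁅w, ⁅w, ⁅w, c⁆⁆⁆⁆ + ⁅w, ⁅y, ⁅w, ⁅w, c⁆⁆⁆⁆ + ⁅w, ⁅w, ⁅y, ⁅w, c⁆⁆⁆⁆ + ⁅w, ⁅w, ⁅w, ⁅y, c⁆⁆⁆⁆)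
    ⁅w, ⁅w, ⁅w, ⁅w, c⁆⁆⁆⁆ (fun l => by
      rw [← hc (y + l • w)]
      simp only [add_lie, lie_add, smul_lie, lie_smul]
      module)
  have h0 : ⁅z, ⁅y, ⁅y, ⁅y, ⁅y, c⁆⁆⁆⁆⁆ = 0 := by rw [hc y, lie_zero]
  rw [hw] at h
  simp only [leibniz_lie z y] at h0
  simp only [lie_add] at h0
  linear_combination (norm := abel) h0 - h

/-- In a division algebra, some inner derivation fixes a nonzero element as soon as some
noncentral element has a nilpotent inner derivation. -/
theorem exists_lie_eq_self (hu : ∀ x : R, x ≠ 0 → IsUnit x) {y d : R} (hd : ⁅y, d⁆ ≠ 0)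
    (h : ∃ n : ℕ, ((fun x => ⁅y, x⁆)^[n]) d = 0) : ∃ z : R, ⁅z, y⁆ = y := by
  classical
  set n := Nat.find h with hn
  have hs := Nat.find_spec h
  have hm := fun m => Nat.find_min h (m := m)
  rw [← hn] at hs
  have n2 : 2 ≤ n := by
    by_contra! hlt
    have : n = 0 ∨ n = 1 := by omega
    rcases this with h0 | h0 <;> rw [h0] at hs
    · simp only [Function.iterate_zero, id] at hs
      exact hd (by rw [hs, lie_zero])
    · exact hd hs
  obtain ⟨k, hk⟩ := Nat.exists_eq_add_of_le' n2
  rw [hk, Function.iterate_succ_apply', Function.iterate_succ_apply'] at hs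
  have hw := hm (k + 1) (by omega)
  rw [Function.iterate_succ_apply'] at hw
  set v := ((fun x => ⁅y, x⁆)^[k]) d
  obtain ⟨u, hu'⟩ := hu _ hw
  have hcomm : y * (↑u⁻¹ : R) = ↑u⁻¹ * y := by
    have h1 : y * (u : R) = u * y := by
      rw [hu']; rwa [Ring.lie_def, sub_eq_zero] at hs
    rw [Units.eq_inv_mul_iff_mul_eq, ← mul_assoc, ← h1, mul_assoc, Units.mul_inv, mul_one]
  -- Here `u = [y, v]` commutes with `y`, so `[y, v u⁻¹ y] = u u⁻¹ y = y`.
  refine ⟨-(v * ↑u⁻¹ * y), ?_⟩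
  have e : ⁅-(v * (↑u⁻¹ : R) * y), y⁆ = ⁅y, v⁆ * ↑u⁻¹ * y := by
    simp only [Ring.lie_def]
    have : y * (v * ↑u⁻¹ * y) = y * v * ↑u⁻¹ * y := by noncomm_ring
    rw [mul_neg, this, sub_mul, sub_mul, mul_assoc v y, hcomm]
    noncomm_ring
  rw [e, ← hu', Units.mul_inv, one_mul]

variable (F) in
/-- In a division algebra over an infinite field, without `2`-torsion, an element killed by all
fourth powers of inner derivations is central. -/
theorem commute_of_ad_four_of_isUnit [Infinite F] (h2 : ∀ x : R, x + x = 0 → x = 0)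
    (hu : ∀ x : R, x ≠ 0 → IsUnit x) {c : R} (hc : ∀ y : R, ⁅y, ⁅y, ⁅y, ⁅y, c⁆⁆⁆⁆ = 0) (x : R) :
    ⁅c, x⁆ = 0 := by
  by_contra hx
  let S : R → Prop := fun c => ∀ y : R, ⁅y, ⁅y, ⁅y, ⁅y, c⁆⁆⁆⁆ = 0
  have hS : ∀ c z, S c → S ⁅z, c⁆ := fun c z h => ad_four_lie_eq_zero F h z
  have hSadd : ∀ a b, S a → S b → S (a + b) := fun a b ha hb y => by
    simp only [lie_add, ha y, hb y, add_zero]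
  have hSneg : ∀ a, S a → S (-a) := fun a ha y => by
    simp only [lie_neg, ha y, neg_zero]
  -- `T` contains `S` and is closed under subtraction and multiplication; for noncentral `c` it
  -- turns out to be all of `R`.
  let T : R → Prop := fun x => ∀ d, S ⁅x, d⁆
  have hST : ∀ a, S a → T a := fun a ha d => by
    rw [← lie_skew]; exact hSneg _ (hS _ _ ha)
  have hTmul : ∀ a b, T a → T b → T (a * b) := fun a b ha hb d => by
    have : ⁅a * b, d⁆ = ⁅a, b * d⁆ + ⁅b, d * a⁆ := by
      simp only [Ring.lie_def]; noncomm_ring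
    rw [this]; exact hSadd _ _ (ha _) (hb _)
  have hTsub : ∀ a b, T a → T b → T (a - b) := fun a b ha hb d => by
    rw [sub_lie, sub_eq_add_neg]; exact hSadd _ _ (ha _) (hSneg _ (hb _))
  -- Otherwise `(ad c)² = 0`, and its value at `x²` gives `2[c, x]² = 0`.
  have hcx : ∃ y, S y ∧ ⁅c, y⁆ ≠ 0 := by
    by_contra! hcon
    have sq : ∀ d : R, ⁅c, ⁅c, d⁆⁆ = 0 := fun d => hcon _ (by
      rw [← lie_skew]; exact hSneg _ (hS c d hc))
    have h0 : ⁅c, x⁆ * ⁅c, x⁆ = 0 := by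
      apply h2
      have h1 := sq (x * x)
      have h3 := sq x
      simp only [Ring.lie_def] at h1 h3 ⊢
      linear_combination (norm := noncomm_ring) h1 - x * h3 - h3 * x
    exact hx ((hu _ hx).mul_left_eq_zero.1 h0)
  obtain ⟨y, hy, hcy⟩ := hcx
  obtain ⟨u, hu'⟩ := hu _ hcy
  have hall : ∀ d, T d := fun d => by
    have h1 : T (⁅c, y⁆ * (↑u⁻¹ * d)) := by
      have : ⁅c, y⁆ * (↑u⁻¹ * d) = ⁅c, y * (↑u⁻¹ * d)⁆ - y * ⁅c, ↑u⁻¹ * d⁆ := by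
        simp only [Ring.lie_def]; noncomm_ring
      rw [this]
      exact hTsub _ _ (hST _ (hST c hc _)) (hTmul _ _ (hST _ hy) (hST _ (hST c hc _)))
    rwa [← hu', Units.mul_inv_cancel_left] at h1
  obtain ⟨z, hz⟩ := exists_lie_eq_self hu hx ⟨5, by
    change ⁅c, ⁅c, ⁅c, ⁅c, ⁅c, x⁆⁆⁆⁆⁆ = 0
    rw [← lie_skew c x]
    simpa only [lie_neg, neg_eq_zero] using hall x c c⟩
  -- As `[z, c] = c`, the vanishing of `(ad z)⁵ c` says `c = 0`.
  have := hall z c z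
  simp only [hz] at this
  rw [this, zero_lie] at hx
  exact hx rfl

end Division

/-! ### Centrality in simple algebras -/

section Center

attribute [local instance] LieRing.ofAssociativeRing

/-- A finite-dimensional simple algebra without nontrivial idempotents is a division algebra. -/
theorem isUnit_of_forall_idempotent (F R : Type*) [Field F] [Ring R] [Algebra F R] [FiniteDimensional F R]
    [IsSimpleRing R]
    (h : ∀ e : R, e * e = e → e = 0 ∨ e = 1) (x : R)
    (hx : x ≠ 0) : IsUnit x := by
  have := IsArtinianRing.of_finite F R
  have hleft : ∀ x : R, x ≠ 0 → ∃ y, y * x = 1 := by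
    intro x hx
    obtain ⟨e, he, hxe⟩ := IsSemisimpleRing.ideal_eq_span_idempotent (Ideal.span {x})
    have hxm : x ∈ Ideal.span {e} := hxe ▸ Ideal.mem_span_singleton_self x
    have hem : e ∈ Ideal.span {x} := hxe ▸ Ideal.mem_span_singleton_self e
    rcases h e he with rfl | rfl
    · simp at hxm; exact absurd hxm hx
    · exact Ideal.mem_span_singleton'.1 hem
  obtain ⟨y, hy⟩ := hleft x hx
  obtain ⟨z, hz⟩ := hleft y (by rintro rfl; simp at hy)
  have : z = x := left_inv_eq_right_inv hz hy
  exact ⟨⟨x, y, this ▸ hz, hy⟩, rfl⟩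

/-- In a finite-dimensional simple algebra without `2`-torsion, an element killed by all fourth
powers of inner derivations is central. -/
theorem commute_of_ad_four (F : Type*) {R : Type*} [Field F] [Ring R] [Algebra F R]
    [FiniteDimensional F R] [IsSimpleRing R] (h2 : ∀ x : R, x + x = 0 → x = 0) {c : R}
    (hc : ∀ y : R, c * y * y * y * y - 4 * (y * c * y * y * y) + 6 * (y * y * c * y * y)
      - 4 * (y * y * y * c * y) + y * y * y * y * c = 0) (x : R) : c * x = x * c := by
  by_cases he : ∃ e : R, e * e = e ∧ e ≠ 0 ∧ e ≠ 1
  · obtain ⟨e, he, he0, he1⟩ := he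
    exact commute_of_commute_idempotents he he0 he1
      (fun f hf => commute_idempotent_of_ad_four hf (hc f)) x
  · have hu := isUnit_of_forall_idempotent F R (fun e h => by
      by_contra! h'
      exact he ⟨e, h, h'⟩)
    rcases finite_or_infinite F with hF | hF
    · have : Finite R := Module.finite_of_finite F
      let _ : DivisionRing R := DivisionRing.ofIsUnitOrEqZero fun a =>
        (em (a = 0)).symm.imp (hu a) id
      exact (littleWedderburn R).mul_comm c x
    · rw [← sub_eq_zero]
      exact commute_of_ad_four_of_isUnit F h2 hu (fun y => by
        simp only [Ring.lie_def]
        linear_combination (norm := noncomm_ring) hc y) x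

end Center

/-! ### Density and inner derivations -/

section Inner

open TensorProduct MulOpposite

/-- A simple algebra is simple as a bimodule over itself. -/
theorem isSimpleModule_mop (F R : Type*) [Field F] [Ring R] [Algebra F R] [IsSimpleRing R] : letI := instModuleTensorProductMop F R
    IsSimpleModule (R ⊗[F] Rᵐᵒᵖ) R := by
  let _ := instModuleTensorProductMop F R
  have hs : ∀ a b x : R, (a ⊗ₜ[F] op b) • x = a * x * b := fun a b x => by
    exact AlgHom.mulLeftRight_apply F R a (op b) x
  refine isSimpleModule_iff_toSpanSingleton_surjective.2 ⟨inferInstance, fun x hx y => ?_⟩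
  exact mem_of_isSimpleRing (Set.range (LinearMap.toSpanSingleton (R ⊗[F] Rᵐᵒᵖ) R x))
    ⟨0, map_zero _⟩
    (by rintro _ _ ⟨a, rfl⟩ ⟨b, rfl⟩; exact ⟨a + b, map_add _ _ _⟩)
    (by
      rintro r _ ⟨b, rfl⟩
      exact ⟨(r ⊗ₜ op 1) * b, by
        simp only [LinearMap.toSpanSingleton_apply, mul_smul, hs, mul_one]⟩)
    (by
      rintro _ r ⟨b, rfl⟩
      exact ⟨(1 ⊗ₜ op r) * b, by
        simp only [LinearMap.toSpanSingleton_apply, mul_smul, hs, one_mul]⟩)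
    ⟨1, by simp⟩ hx y

variable {F R : Type*} [Field F] [Ring R] [Algebra F R] [FiniteDimensional F R] [IsSimpleRing R]

/-- Jacobson density for the bimodule structure of a finite-dimensional simple algebra: every
map linear over the center is a sum of two-sided multiplications. -/
theorem exists_sum_mul_mul (f : R →ₗ[F] R)
    (hf : ∀ z : R, (∀ x, z * x = x * z) → ∀ x, f (z * x) = z * f x) :
    ∃ s : Finset (R × R), ∀ x, f x = ∑ p ∈ s, p.1 * x * p.2 := by
  classical
  let _ := instModuleTensorProductMop F R
  have := isSimpleModule_mop F R
  have hs : ∀ a b x : R, (a ⊗ₜ[F] op b) • x = a * x * b := fun a b x => by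
    exact AlgHom.mulLeftRight_apply F R a (op b) x
  let g : Module.End (Module.End (R ⊗[F] Rᵐᵒᵖ) R) R :=
    { toFun := f
      map_add' := map_add f
      map_smul' := fun φ x => by
        -- A bimodule endomorphism is multiplication by the central element `φ 1`.
        have hl : ∀ a b x, φ (a * x * b) = a * φ x * b := fun a b x => by
          rw [← hs, map_smul, hs]
        have h1 : ∀ x, φ x = φ 1 * x := fun x => by simpa using hl 1 x 1
        have h2 : ∀ x, φ x = x * φ 1 := fun x => by simpa using hl x 1 1
        change f (φ x) = φ (f x)
        rw [h1 x, h1 (f x)]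
        exact hf _ (fun x => by rw [← h1, h2]) x }
  let b := Module.finBasis F R
  obtain ⟨t, ht⟩ := jacobson_density g (Finset.univ.image b)
  obtain ⟨s, hs'⟩ := TensorProduct.exists_finset t
  refine ⟨s.map ⟨fun p => (p.1, p.2.unop), fun p q h => by
    simpa [Prod.ext_iff] using h⟩, fun x => ?_⟩
  have key : f = ∑ p ∈ s, LinearMap.mulLeftRight F (p.1, p.2.unop) := by
    refine b.ext fun i => ?_
    have := ht (b i) (Finset.mem_image_of_mem _ (Finset.mem_univ i))
    change f (b i) = _ at this
    rw [this, hs', Finset.sum_smul, LinearMap.sum_apply]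
    refine Finset.sum_congr rfl fun p _ => ?_
    rw [LinearMap.mulLeftRight_apply, ← hs, op_unop]
  rw [key, LinearMap.sum_apply, Finset.sum_map]
  refine Finset.sum_congr rfl fun p _ => ?_
  exact LinearMap.mulLeftRight_apply p.1 p.2.unop x

/-- A derivation of a finite-dimensional simple algebra that kills the center is inner. -/
theorem isInnerDerivation_of_derivation (E : R →ₗ[F] R)
    (hE : ∀ x y, E (x * y) = E x * y + x * E y)
    (hz : ∀ z : R, (∀ x, z * x = x * z) → E z = 0) : IsInnerDerivation F E := by
  obtain ⟨s, hs⟩ := exists_sum_mul_mul E (fun z hz' x => by rw [hE, hz z hz', zero_mul, zero_add])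
  let _ : Field (Subring.center R) := (IsSimpleRing.isField_center R).toField
  obtain ⟨φ, hφ⟩ : ∃ φ : R →ₗ[Subring.center R] Subring.center R, φ 1 = 1 := 
    Module.Projective.exists_dual_eq_one (Subring.center R) (one_ne_zero (α := R))
  let f : R →ₗ[F] R :=
    { toFun := fun x => φ x
      map_add' := fun x y => by simp
      map_smul' := fun r x => by
        have : r • x = (⟨algebraMap F R r, Subring.mem_center_iff.2 fun y =>
          (Algebra.commutes r y).symm⟩ : Subring.center R) • x := by
          rw [Subring.smul_def, smul_eq_mul, Algebra.smul_def]
        rw [this, map_smul, RingHom.id_apply, Algebra.smul_def r]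
        rfl }
  have hfz : ∀ x y, f x * y = y * f x := fun x y =>
    (Subring.mem_center_iff.1 (φ x).2 y).symm
  have hf1 : f 1 = 1 := by simp [f, hφ]
  obtain ⟨t, ht⟩ := exists_sum_mul_mul f (fun z hz x => by
    have : z * x = (⟨z, Subring.mem_center_iff.2 fun y => (hz y).symm⟩ : Subring.center R) • x := by
      rw [Subring.smul_def, smul_eq_mul]
    simp only [f, LinearMap.coe_mk, AddHom.coe_mk]
    rw [this, map_smul]
    simp)
  -- Both sides equal the double sum of `p₁ r q₁ p₂ q₂`. As `f` is central-valued and `∑ q₁ q₂ = f 1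
  -- = 1`, comparison with `r = 1` gives `E(r) + ra = ar` for `a = ∑ E(q₁) q₂`.
  have hsum : ∀ r, ∑ q ∈ t, E (r * q.1) * q.2 = ∑ p ∈ s, p.1 * r * f p.2 := by
    intro r
    simp only [hs, ht, Finset.mul_sum, Finset.sum_mul]
    rw [Finset.sum_comm]
    exact Finset.sum_congr rfl fun p _ => Finset.sum_congr rfl fun q _ => by
      simp only [mul_assoc]
  refine ⟨∑ q ∈ t, E q.1 * q.2, fun r => ?_⟩
  have h1 := hsum r
  have h2 := hsum 1
  have h3 : ∑ p ∈ s, p.1 * r * f p.2 = (∑ p ∈ s, p.1 * 1 * f p.2) * r := by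
    rw [Finset.sum_mul]
    exact Finset.sum_congr rfl fun p _ => by rw [mul_one, mul_assoc, mul_assoc, hfz]
  simp only [one_mul] at h2
  rw [h3, ← h2] at h1
  have h4 : ∑ q ∈ t, E (r * q.1) * q.2 = E r + r * ∑ q ∈ t, E q.1 * q.2 := by
    have : E r = E r * ∑ q ∈ t, q.1 * q.2 := by
      have := ht 1
      simp only [mul_one, hf1] at this
      rw [← this, mul_one]
    rw [this, Finset.mul_sum, Finset.mul_sum, ← Finset.sum_add_distrib]
    exact Finset.sum_congr rfl fun q _ => by rw [hE]; noncomm_ring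
  rw [h4] at h1
  rw [← h1]
  noncomm_ring

end Inner

/-! ### The commutator space -/

section Commutators

variable {F : Type*} [Field F]

theorem commutator_mem {A : Type*} [NonUnitalRing A] [Module F A] (x y : A) :
    x * y - y * x ∈ commutatorSpan F A :=
  Submodule.subset_span ⟨x, y, rfl⟩

/-- A linear map that is symmetric under exchange of factors kills the commutators. -/
theorem commutatorSpan_le_ker {A M : Type*} [NonUnitalRing A] [Module F A] [AddCommGroup M]
    [Module F M] (f : A →ₗ[F] M) (hf : ∀ x y, f (x * y) = f (y * x)) :
    commutatorSpan F A ≤ LinearMap.ker f := by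
  refine Submodule.span_le.2 ?_
  rintro _ ⟨x, y, rfl⟩
  simp [hf x y]

theorem map_mem_commutatorSpan {A B : Type*} [NonUnitalRing A] [Module F A] [NonUnitalRing B]
    [Module F B] (f : A →ₗ[F] B) (hf : ∀ x y, f (x * y) = f x * f y) {x : A}
    (hx : x ∈ commutatorSpan F A) : f x ∈ commutatorSpan F B := by
  have : commutatorSpan F A ≤ (commutatorSpan F B).comap f := by
    refine Submodule.span_le.2 ?_
    rintro _ ⟨x, y, rfl⟩
    simpa [hf] using commutator_mem (F := F) (f x) (f y)
  exact this hx

variable {R : Type*} [Ring R] [Algebra F R]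

/-- `[R, R]` is stable under multiplication by central elements. -/
theorem central_mul_mem {z : R} (hz : ∀ x, z * x = x * z) {w : R}
    (hw : w ∈ commutatorSpan F R) : z * w ∈ commutatorSpan F R := by
  have : commutatorSpan F R ≤ (commutatorSpan F R).comap (LinearMap.mulLeft F z) := by
    refine Submodule.span_le.2 ?_
    rintro _ ⟨x, y, rfl⟩
    have : z * (x * y - y * x) = (z * x) * y - y * (z * x) := by
      rw [mul_sub, ← mul_assoc y z x, ← hz y]; noncomm_ring
    simpa [this] using commutator_mem (F := F) (z * x) y
  exact this hw

end Commutators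

/-! ### Traces and nondegeneracy modulo commutators -/

section Trace

open TensorProduct

variable (F : Type*) {R : Type*} [Field F] [Ring R] [Algebra F R] [FiniteDimensional F R]

variable (R) in
/-- A nonzero finite-dimensional algebra has a matrix algebra quotient over the algebraic closure
of the ground field. -/
theorem exists_surjective_matrix [Nontrivial R] :
    ∃ (n : ℕ) (_ : NeZero n) (π : AlgebraicClosure F ⊗[F] R →ₐ[AlgebraicClosure F]
      Matrix (Fin n) (Fin n) (AlgebraicClosure F)), Function.Surjective π := by
  set K := AlgebraicClosure F
  have : IsArtinianRing (K ⊗[F] R) := IsArtinianRing.of_finite K _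
  set J := Ring.jacobson (K ⊗[F] R)
  have hJ : J ≠ ⊤ := by
    intro h
    have := Ring.jacobson_lt_top (K ⊗[F] R)
    exact this.ne h
  have : Nontrivial ((K ⊗[F] R) ⧸ J) := Ideal.Quotient.nontrivial_iff.2 hJ
  have : FiniteDimensional K ((K ⊗[F] R) ⧸ J) :=
    Module.Finite.of_surjective (Ideal.Quotient.mkₐ K J).toLinearMap Ideal.Quotient.mk_surjective
  obtain ⟨n, d, hd, ⟨e⟩⟩ := IsSemisimpleRing.exists_algEquiv_pi_matrix_of_isAlgClosed K
    ((K ⊗[F] R) ⧸ J)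
  have hn : Nonempty (Fin n) := by
    by_contra h
    rw [not_nonempty_iff] at h
    exact not_subsingleton _ e.toEquiv.subsingleton
  obtain ⟨i⟩ := hn
  refine ⟨d i, hd i, (Pi.evalAlgHom K _ i).comp (e.toAlgHom.comp (Ideal.Quotient.mkₐ K J)), ?_⟩
  exact (Function.surjective_eval i).comp (e.surjective.comp Ideal.Quotient.mk_surjective)

variable (R) in
/-- A nonzero unital finite-dimensional algebra is not spanned by commutators. -/
theorem exists_notMem_commutatorSpan [Nontrivial R] : ∃ x : R, x ∉ commutatorSpan F R := by
  by_contra! h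
  obtain ⟨n, hn, π, hπ⟩ := exists_surjective_matrix F R
  set K := AlgebraicClosure F
  let τ : R →ₗ[F] K := (Matrix.traceLinearMap (Fin n) F K) ∘ₗ (π.toLinearMap.restrictScalars F) ∘ₗ
    (Algebra.TensorProduct.includeRight : R →ₐ[F] K ⊗[F] R).toLinearMap
  have hτ : ∀ x, τ x = (π (1 ⊗ₜ x)).trace := fun x => rfl
  have hτ0 : ∀ x, τ x = 0 := fun x => commutatorSpan_le_ker τ (fun x y => by
    have e : ∀ x y : R, (1 : K) ⊗ₜ[F] (x * y) = (1 ⊗ₜ x) * (1 ⊗ₜ y) := fun x y => by simp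
    rw [hτ, hτ, e, e, map_mul, map_mul, Matrix.trace_mul_comm]) (h x)
  have hall : ∀ X, (π X).trace = 0 := by
    intro X
    induction X with
    | zero => simp
    | add x y hx hy => rw [map_add, Matrix.trace_add, hx, hy, add_zero]
    | tmul a x =>
      have : a ⊗ₜ[F] x = a • ((1 : K) ⊗ₜ[F] x) := by simp [TensorProduct.smul_tmul']
      rw [this, map_smul, Matrix.trace_smul, ← hτ, hτ0, smul_zero]
  obtain ⟨X, hX⟩ := hπ (Matrix.single 0 0 1)
  have := hall X
  rw [hX, Matrix.trace_single_eq_same] at this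
  exact one_ne_zero this

variable (R) in
/-- Not all cubes of a nonzero unital finite-dimensional algebra of characteristic not `2` are sums
of commutators. -/
theorem exists_cube_notMem_commutatorSpan [Nontrivial R] (h2 : (2 : F) ≠ 0) :
    ∃ x : R, x * x * x ∉ commutatorSpan F R := by
  by_contra! h
  by_cases h3 : (3 : F) = 0
  · obtain ⟨n, hn, π, hπ⟩ := exists_surjective_matrix F R
    set K := AlgebraicClosure F
    have h3K : (3 : K) = 0 := by
      have := congrArg (algebraMap F K) h3
      rwa [map_ofNat, map_zero] at this
    let τ : R →ₗ[F] K := (Matrix.traceLinearMap (Fin n) F K) ∘ₗ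
      (π.toLinearMap.restrictScalars F) ∘ₗ
      (Algebra.TensorProduct.includeRight : R →ₐ[F] K ⊗[F] R).toLinearMap
    have hτ : ∀ x, τ x = (π (1 ⊗ₜ x)).trace := fun x => rfl
    have e : ∀ x y : R, (1 : K) ⊗ₜ[F] (x * y) = (1 ⊗ₜ x) * (1 ⊗ₜ y) := fun x y => by simp
    have hτ0 : ∀ x, τ (x * x * x) = 0 := fun x => commutatorSpan_le_ker τ (fun x y => by
      rw [hτ, hτ, e, e, map_mul, map_mul, Matrix.trace_mul_comm]) (h x)
    -- In characteristic 3 the mixed terms of `tr (X + Y)³` cancel, so vanishing on `R` passes to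
    -- the scalar extension.
    have hadd : ∀ X Y : Matrix (Fin n) (Fin n) K, ((X + Y) * (X + Y) * (X + Y)).trace
        = (X * X * X).trace + (Y * Y * Y).trace := by
      intro X Y
      have : (X + Y) * (X + Y) * (X + Y) = X * X * X + Y * Y * Y
        + (X * X * Y + X * Y * X + Y * X * X) + (Y * Y * X + Y * X * Y + X * Y * Y) := by
        noncomm_ring
      rw [this]
      simp only [Matrix.trace_add]
      have c1 := Matrix.trace_mul_comm (X * Y) X
      have c2 := Matrix.trace_mul_comm Y (X * X)
      have c3 := Matrix.trace_mul_comm (Y * X) Y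
      have c4 := Matrix.trace_mul_comm X (Y * Y)
      simp only [← mul_assoc] at c1 c2 c3 c4
      linear_combination c1 + c2 + c3 + c4 + ((X * X * Y).trace + (Y * Y * X).trace) * h3K
    have hall : ∀ X, (π X * π X * π X).trace = 0 := by
      intro X
      induction X with
      | zero => simp
      | add x y hx hy => rw [map_add, hadd, hx, hy, add_zero]
      | tmul a x =>
        have : a ⊗ₜ[F] x = a • ((1 : K) ⊗ₜ[F] x) := by simp [TensorProduct.smul_tmul']
        have h1 := hτ0 x
        rw [hτ, e, e, map_mul, map_mul] at h1
        rw [this, map_smul]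
        simp only [smul_mul_assoc, mul_smul_comm, Matrix.trace_smul, h1, smul_zero]
    obtain ⟨X, hX⟩ := hπ (Matrix.single 0 0 1)
    have := hall X
    rw [hX] at this
    simp at this
  · obtain ⟨x, hx⟩ := exists_notMem_commutatorSpan F R
    apply hx
    have h6 : (6 : F) ≠ 0 := by
      rw [show (6 : F) = 2 * 3 by norm_num]; exact mul_ne_zero h2 h3
    have := (commutatorSpan F R).sub_mem
      ((commutatorSpan F R).add_mem (h (x + 1)) (h (x - 1)))
      ((commutatorSpan F R).add_mem (h x) (h x))
    have e : (x + 1) * (x + 1) * (x + 1) + (x - 1) * (x - 1) * (x - 1)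
        - (x * x * x + x * x * x) = (6 : F) • x := by
      rw [show (6 : F) • x = (6 : ℕ) • x by rw [← Nat.cast_smul_eq_nsmul F]; norm_num]
      noncomm_ring
    rw [e] at this
    exact ((commutatorSpan F R).smul_mem_iff h6).1 this

variable {F} in
/-- The commutator quotient of a simple algebra is nondegenerate. -/
theorem eq_zero_of_forall_mul_mem [IsSimpleRing R] {a : R}
    (h : ∀ x, a * x ∈ commutatorSpan F R) : a = 0 := by
  by_contra ha
  obtain ⟨x, hx⟩ := exists_notMem_commutatorSpan F R
  have := mem_of_isSimpleRing {a : R | ∀ x, a * x ∈ commutatorSpan F R} (by simp)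
    (fun hx hy z => by rw [add_mul]; exact add_mem (hx z) (hy z))
    (fun {r a} ha z => by
      have h1 := add_mem (commutator_mem (F := F) r (a * z)) (ha (z * r))
      convert h1 using 1
      noncomm_ring)
    (fun {a r} ha z => by rw [mul_assoc]; exact ha _) h ha 1 x
  rw [one_mul] at this
  exact hx this

end Trace

/-! ### Polarization modulo commutators -/

section Identities

variable {F A : Type*} [Field F] [NonUnitalRing A] [Module F A]

theorem mkQ_mul_comm (x y : A) :
    (commutatorSpan F A).mkQ (x * y) = (commutatorSpan F A).mkQ (y * x) := by
  rw [← sub_eq_zero, ← map_sub, Submodule.mkQ_apply, Submodule.Quotient.mk_eq_zero]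
  exact commutator_mem x y

theorem mkQ_eq_zero_iff {x : A} : (commutatorSpan F A).mkQ x = 0 ↔ x ∈ commutatorSpan F A := by
  rw [Submodule.mkQ_apply, Submodule.Quotient.mk_eq_zero]

theorem mkQ_mul_mul_cube {D : A →ₗ[F] A}
    (hD : ∀ x : A, x * D x * x ∈ commutatorSpan F A) (x : A) :
    (commutatorSpan F A).mkQ (D x * x * x) = 0 := by
  rw [mkQ_mul_comm, ← mul_assoc]
  exact mkQ_eq_zero_iff.2 (hD x)

theorem eq_zero_of_add_self {V : Type*} [AddCommGroup V] [Module F V] (h2 : (2 : F) ≠ 0) {v : V}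
    (h : v + v = 0) : v = 0 := by
  rw [← two_smul F] at h
  exact (smul_eq_zero.1 h).resolve_left h2

/-- The partial polarization of the cubic identity. -/
theorem mkQ_polarization (h2 : (2 : F) ≠ 0) {D : A →ₗ[F] A}
    (hD : ∀ x : A, x * D x * x ∈ commutatorSpan F A) (x y : A) :
    (commutatorSpan F A).mkQ (D x * y * y) + (commutatorSpan F A).mkQ (D y * x * y)
      + (commutatorSpan F A).mkQ (D y * y * x) = 0 := by
  apply eq_zero_of_add_self h2
  have h := mkQ_mul_mul_cube hD
  have h1 := h (x + y)
  have h3 := h (x - y)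
  have h4 := h x
  simp only [map_add, map_sub, add_mul, mul_add, sub_mul, mul_sub] at h1 h3
  linear_combination (norm := abel) h1 + h3 - h4 - h4

end Identities

/-! ### The simple case -/

section SimpleCase

variable {F R : Type*} [Field F] [Ring R] [Algebra F R] [FiniteDimensional F R] [IsSimpleRing R]

/-- The squaring rule for maps satisfying the cubic identity. -/
theorem two_map_sq (h2 : (2 : F) ≠ 0) {D : R →ₗ[F] R}
    (hD : ∀ x : R, x * D x * x ∈ commutatorSpan F R) (y : R) :
    2 * D (y * y) = 2 * (D y * y + y * D y) - (D 1 * (y * y) + y * y * D 1) := by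
  rw [← sub_eq_zero]
  refine eq_zero_of_forall_mul_mem (F := F) fun x => ?_
  rw [← mkQ_eq_zero_iff]
  have p := mkQ_polarization h2 hD
  have h1 := p x y
  -- Linearizing the quadratic variable in the direction `1` produces `2D(y²)x` and `2D(x)y²`; the
  -- latter is removed by `h1`.
  have lin := p (y * y) (x + 1)
  have lin1 := p (y * y) x
  have lin2 := p (y * y) 1
  simp only [map_add, add_mul, mul_add, mul_one, ← mul_assoc] at lin lin1 lin2
  have c1 : (commutatorSpan F R).mkQ (D y * x * y) = (commutatorSpan F R).mkQ (y * D y * x) := by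
    rw [mkQ_mul_comm, mul_assoc]
  have c2 : (commutatorSpan F R).mkQ (D 1 * x * y * y)
      = (commutatorSpan F R).mkQ (y * y * D 1 * x) := by
    rw [mul_assoc, mkQ_mul_comm]; simp only [mul_assoc]
  rw [c1] at h1
  simp only [two_mul, sub_mul, add_mul, map_add, map_sub, ← mul_assoc]
  rw [← c2]
  linear_combination (norm := abel) lin - lin1 - lin2 - h1 - h1

/-- A linear map of a simple algebra satisfying the cubic identity is an inner derivation. -/
theorem isInnerDerivation_of_isSimpleRing (h2 : (2 : F) ≠ 0) {D : R →ₗ[F] R}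
    (hD : ∀ x : R, x * D x * x ∈ commutatorSpan F R) : IsInnerDerivation F D := by
  have h2R : ∀ x : R, x + x = 0 → x = 0 := fun x => eq_zero_of_add_self h2
  set c := D 1 with hc
  have sq := two_map_sq h2 hD
  rw [← hc] at sq
  have central : ∀ x, c * x = x * c := by
    -- This symmetric correction has `E 1 = 0` and turns the defect in `sq` into the double
    -- commutator `[[c, y], y]`.
    let E : R →ₗ[F] R := (2 : F) • D - LinearMap.mulLeft F c - LinearMap.mulRight F c
    have hE : ∀ x, E x = 2 * D x - c * x - x * c := fun x => by
      simp [E, two_smul, two_mul]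
    refine commute_of_ad_four F h2R (ad_four_eq_zero E.toAddMonoidHom c fun y => ?_)
    simp only [LinearMap.toAddMonoidHom_coe, hE]
    linear_combination (norm := noncomm_ring) sq y
  let E : R →ₗ[F] R := D - LinearMap.mulLeft F c
  have hE : ∀ x, E x = D x - c * x := fun x => by simp [E]
  have der : ∀ x y, E (x * y) = E x * y + x * E y := by
    refine derivation_of_jordan h2R eq_zero_or_eq_zero_of_forall_mul_mul E.toAddMonoidHom
      fun y => ?_
    simp only [LinearMap.toAddMonoidHom_coe, hE]
    rw [← sub_eq_zero]
    apply h2R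
    linear_combination (norm := noncomm_ring) sq y - central y * y + y * central y
  have p := mkQ_polarization h2 hD
  have tr : ∀ x, E x + (3 : F) • (c * x) ∈ commutatorSpan F R := by
    intro x
    rw [← mkQ_eq_zero_iff, hE]
    have h := p x 1
    simp only [mul_one, ← hc] at h
    rw [show D x - c * x + (3 : F) • (c * x) = D x + c * x + c * x by module]
    simpa only [map_add] using h
  have killsCenter : ∀ z : R, (∀ x, z * x = x * z) → E z = 0 := by
    intro z hz
    refine eq_zero_of_forall_mul_mem (F := F) fun x => ?_
    have h1 := tr (z * x)
    have h3 := central_mul_mem hz (tr x)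
    -- The multiples of `c` cancel and `E(z)x` remains.
    have h4 := sub_mem h1 h3
    rw [der] at h4
    convert h4 using 1
    rw [mul_add, mul_smul_comm, ← mul_assoc c z x, central z, ← mul_assoc]
    abel
  obtain ⟨a, ha⟩ := isInnerDerivation_of_derivation E der killsCenter
  have cz : c = 0 := by
    by_contra hc0
    obtain ⟨x, hx⟩ := exists_cube_notMem_commutatorSpan F R h2
    have h1 := mkQ_mul_mul_cube hD x
    rw [show D x = E x + c * x by rw [hE]; abel, ha] at h1
    have h3 : c * (x * x * x) ∈ commutatorSpan F R := by
      rw [← mkQ_eq_zero_iff, ← h1]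
      have h4 := mkQ_mul_comm (F := F) (a * x * x) x
      simp only [sub_mul, add_mul, map_add, map_sub, ← mul_assoc] at h4 ⊢
      rw [h4]
      abel
    obtain ⟨d, hd⟩ := (IsSimpleRing.isField_center R).mul_inv_cancel
      (a := ⟨c, Subring.mem_center_iff.2 fun y => (central y).symm⟩)
      (fun h => hc0 (congrArg Subtype.val h))
    have hd' : c * d = 1 := congrArg Subtype.val hd
    have h5 := central_mul_mem (z := (d : R))
      (fun y => (Subring.mem_center_iff.1 d.2 y).symm) h3
    rw [← mul_assoc, ← central, hd', one_mul] at h5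
    exact hx h5
  refine ⟨a, fun x => ?_⟩
  rw [← ha, hE, cz, zero_mul, sub_zero]

end SimpleCase

/-! ### Products of simple algebras -/

section Product

/-- The semisimple case, for algebras given as products of simple algebras. -/
theorem isInnerDerivation_pi {F : Type*} [Field F] {ι : Type*} [Fintype ι] {R : ι → Type*}
    [∀ i, Ring (R i)] [∀ i, Algebra F (R i)] [∀ i, FiniteDimensional F (R i)]
    [∀ i, IsSimpleRing (R i)] (h2 : (2 : F) ≠ 0) {D : (∀ i, R i) →ₗ[F] (∀ i, R i)}
    (hD : ∀ x, x * D x * x ∈ commutatorSpan F (∀ i, R i)) : IsInnerDerivation F D := by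
  classical
  have proj : ∀ i (x : ∀ i, R i), x ∈ commutatorSpan F (∀ i, R i) →
      x i ∈ commutatorSpan F (R i) := fun i x hx =>
    map_mem_commutatorSpan (LinearMap.proj (R := F) (φ := R) i) (fun _ _ => rfl) hx
  have off : ∀ i (x : ∀ i, R i), x i = 0 → D x i = 0 := by
    intro i x hx
    have key : ∀ y : R i, D x i * y * y ∈ commutatorSpan F (R i) := by
      intro y
      have h := mkQ_polarization h2 hD x (Pi.single i y)
      have hx1 : x * Pi.single i y = 0 := by
        ext j
        by_cases h : j = i
        · subst h; simp [hx]
        · simp [h]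
      have hx2 : Pi.single i y * x = 0 := by
        ext j
        by_cases h : j = i
        · subst h; simp [hx]
        · simp [h]
      rw [mul_assoc (D _) x, hx1, mul_assoc (D (Pi.single i y)), hx2] at h
      simp only [mul_zero, map_zero, add_zero] at h
      have := proj i _ (mkQ_eq_zero_iff.1 h)
      simpa using this
    refine eq_zero_of_forall_mul_mem (F := F) fun y => ?_
    rw [← mkQ_eq_zero_iff]
    apply eq_zero_of_add_self h2
    -- Replacing `y` by `y + 1` extracts the linear term `2 D(x)ᵢ y`.
    have h1 := mkQ_eq_zero_iff.2 (key (y + 1))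
    have h3 := mkQ_eq_zero_iff.2 (key y)
    have h4 := mkQ_eq_zero_iff.2 (key 1)
    simp only [mul_add, add_mul, mul_one, map_add] at h1 h4
    linear_combination (norm := abel) h1 - h3 - h4
  have comp : ∀ i, IsInnerDerivation F
      ((LinearMap.proj i : (∀ i, R i) →ₗ[F] R i) ∘ₗ D ∘ₗ LinearMap.single F R i) := by
    intro i
    refine isInnerDerivation_of_isSimpleRing h2 fun x => ?_
    have := proj i _ (hD (Pi.single i x))
    simpa using this
  choose a ha using comp
  refine ⟨a, fun x => funext fun i => ?_⟩
  have h1 := ha i (x i)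
  have h3 := off i (x - Pi.single i (x i)) (by simp)
  rw [map_sub, Pi.sub_apply, sub_eq_zero] at h3
  rw [h3]
  simpa using h1

/-- A linear map of a unital semisimple algebra satisfying the cubic identity is an inner
derivation. -/
theorem isInnerDerivation_of_isSemisimpleRing {F R : Type*} [Field F] [Ring R] [Algebra F R]
    [FiniteDimensional F R] [IsSemisimpleRing R] (h2 : (2 : F) ≠ 0) {D : R →ₗ[F] R}
    (hD : ∀ x, x * D x * x ∈ commutatorSpan F R) : IsInnerDerivation F D := by
  obtain ⟨n, K, d, _, _, _, hd, ⟨e⟩⟩ :=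
    IsSemisimpleRing.exists_algEquiv_pi_matrix_divisionRing_finite F R
  obtain ⟨a, ha⟩ := isInnerDerivation_pi (R := fun i => Matrix (Fin (d i)) (Fin (d i)) (K i)) h2
    (D := e.toLinearMap ∘ₗ D ∘ₗ e.symm.toLinearMap) (fun x => by
      have := map_mem_commutatorSpan e.toLinearMap (fun x y => map_mul e x y) (hD (e.symm x))
      simpa using this)
  refine ⟨e.symm a, fun x => e.injective ?_⟩
  simpa using ha (e x)

end Product

/-! ### From nonunital semisimple to unital -/

section NonUnital

variable {F A : Type*} [Field F] [NonUnitalRing A] [Module F A]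

theorem eq_bot_of_isNilpotentSubspace (hA : IsSemisimple F A) {I : Submodule F A}
    (hI : IsIdeal F I) (hn : IsNilpotentSubspace F I) : I = ⊥ :=
  le_bot_iff.1 (hA ▸ le_sSup ⟨hI, hn⟩)

/-- Under a homomorphism to a unital algebra, the preimage of a nilpotent ideal is a
nilpotent ideal, hence vanishes in a semisimple algebra. -/
theorem eq_zero_of_map_mem_nilpotent (hA : IsSemisimple F A) {S : Type*} [Ring S] [Algebra F S]
    (f : A →ₗ[F] S) (hf : ∀ x y, f (x * y) = f x * f y) (hinj : Function.Injective f)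
    (J : Ideal S) [J.IsTwoSided] (hJ : IsNilpotent J) {x : A} (hx : f x ∈ J) : x = 0 := by
  let I : Submodule F A := (J.restrictScalars F).comap f
  have hmem : ∀ x, x ∈ I ↔ f x ∈ J := fun x => Iff.rfl
  have hpow : ∀ n, ∀ z ∈ power F I n, f z ∈ J ^ (n + 1) := by
    intro n
    induction n with
    | zero => intro z hz; rw [zero_add, Submodule.pow_one]; exact (hmem z).1 hz
    | succ n ih =>
      intro z hz
      have : power F I (n + 1) ≤ ((J ^ (n + 1 + 1)).restrictScalars F).comap f := by
        refine Submodule.span_le.2 ?_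
        rintro _ ⟨x, hx, y, hy, rfl⟩
        change f (x * y) ∈ J ^ (n + 1 + 1)
        rw [hf, Submodule.pow_succ]
        exact Ideal.mul_mem_mul (ih x hx) ((hmem y).1 hy)
      exact this hz
  have hbot : I = ⊥ := by
    refine eq_bot_of_isNilpotentSubspace hA (fun x hx a => ⟨?_, ?_⟩) ?_
    · rw [hmem, hf]; exact J.mul_mem_left _ hx
    · rw [hmem, hf]; exact J.mul_mem_right _ hx
    · obtain ⟨n, hn⟩ := hJ
      refine ⟨n, (Submodule.eq_bot_iff _).2 fun z hz => hinj ?_⟩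
      have := hpow n z hz
      rw [Submodule.pow_succ, hn, Ideal.zero_eq_bot, Submodule.bot_mul] at this
      rw [map_zero]
      exact this
  have : x ∈ I := hx
  rwa [hbot, Submodule.mem_bot] at this

variable [IsScalarTower F A A] [SMulCommClass F A A] [FiniteDimensional F A]

/-- A semisimple finite-dimensional algebra has a right identity. -/
theorem exists_right_identity (hA : IsSemisimple F A) : ∃ e : A, ∀ x, x * e = x := by
  have : FiniteDimensional F (Unitization F A) :=
    Module.Finite.of_surjective
      ((Algebra.linearMap F (Unitization F A)).coprod (Unitization.inrHom F F A)) fun u =>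
      ⟨(u.fst, u.snd), Unitization.inl_fst_add_inr_snd_eq u⟩
  have : IsArtinianRing (Unitization F A) := IsArtinianRing.of_finite F _
  set J := Ring.jacobson (Unitization F A)
  let m : Unitization F A →+* Unitization F A ⧸ J := Ideal.Quotient.mk J
  have hm : ∀ a : A, m a = 0 → a = 0 := fun a ha =>
    eq_zero_of_map_mem_nilpotent hA (Unitization.inrHom F F A) (fun x y => Unitization.inr_mul F x y)
      Unitization.inr_injective J IsSemiprimaryRing.isNilpotent (Ideal.Quotient.eq_zero_iff_mem.1 ha)
  -- `A` embeds in the semisimple quotient as a left ideal; an idempotent generator of its image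
  -- lifts to a right identity.
  let L : Ideal (Unitization F A ⧸ J) :=
    { carrier := {q | ∃ a : A, m a = q}
      zero_mem' := ⟨0, by simp⟩
      add_mem' := by
        rintro _ _ ⟨a, rfl⟩ ⟨b, rfl⟩
        exact ⟨a + b, by rw [Unitization.inr_add, map_add]⟩
      smul_mem' := by
        rintro q _ ⟨a, rfl⟩
        obtain ⟨u, rfl⟩ := Ideal.Quotient.mk_surjective q
        refine ⟨u.fst • a + u.snd * a, ?_⟩
        rw [smul_eq_mul]
        change m _ = m u * m a
        rw [← map_mul]
        congr 1
        ext <;> simp }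
  obtain ⟨q, hq, hL⟩ := IsSemisimpleRing.ideal_eq_span_idempotent L
  obtain ⟨e, he⟩ : q ∈ L := hL ▸ Ideal.mem_span_singleton_self q
  refine ⟨e, fun x => ?_⟩
  have hx : m x ∈ Ideal.span {q} := hL ▸ (⟨x, rfl⟩ : m x ∈ L)
  obtain ⟨r, hr⟩ := Ideal.mem_span_singleton'.1 hx
  rw [← sub_eq_zero]
  apply hm
  rw [Unitization.inr_sub, Unitization.inr_mul, map_sub, map_mul, he, ← hr, mul_assoc, hq.eq,
    sub_self]

/-- A semisimple finite-dimensional algebra has an identity. -/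
theorem exists_identity (hA : IsSemisimple F A) : ∃ e : A, ∀ x, e * x = x ∧ x * e = x := by
  obtain ⟨e, he⟩ := exists_right_identity hA
  refine ⟨e, fun x => ⟨?_, he x⟩⟩
  have hN : LinearMap.ker (LinearMap.mulLeft F e) = ⊥ := by
    have hmem : ∀ x, x ∈ LinearMap.ker (LinearMap.mulLeft F e) ↔ e * x = 0 := fun x => by simp
    have hz : ∀ a x, e * x = 0 → a * x = 0 := fun a x hx => by
      rw [← he a, mul_assoc, hx, mul_zero]
    -- The kernel is annihilated from the left by all of `A`, so its square is zero; index `1` of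
    -- `power` is the square.
    refine eq_bot_of_isNilpotentSubspace hA (fun x hx a => ⟨?_, ?_⟩) ⟨1, ?_⟩
    · rw [hz a x ((hmem x).1 hx)]; exact Submodule.zero_mem _
    · rw [hmem, ← mul_assoc, (hmem x).1 hx, zero_mul]
    · refine le_bot_iff.1 (Submodule.span_le.2 ?_)
      rintro _ ⟨x, -, y, hy, rfl⟩
      exact hz x y ((hmem y).1 hy)
  have h : e * x - x ∈ LinearMap.ker (LinearMap.mulLeft F e) := by
    simp [mul_sub, ← mul_assoc, he]
  rwa [hN, Submodule.mem_bot, sub_eq_zero] at h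

/-- A linear map of a semisimple algebra satisfying the cubic identity is an inner derivation. -/
theorem isInnerDerivation_of_isSemisimple (h2 : (2 : F) ≠ 0) (hA : IsSemisimple F A)
    {D : A →ₗ[F] A} (hD : ∀ x, x * D x * x ∈ commutatorSpan F A) : IsInnerDerivation F D := by
  obtain ⟨e, he⟩ := exists_identity hA
  let _ : Ring A := { ‹NonUnitalRing A› with
    one := e
    one_mul := fun x => (he x).1
    mul_one := fun x => (he x).2 }
  let _ : Algebra F A := Algebra.ofModule smul_mul_assoc mul_smul_comm
  have : IsArtinianRing A := IsArtinianRing.of_finite F A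
  have : IsSemisimpleRing A := by
    rw [IsArtinianRing.isSemisimpleRing_iff_jacobson, Submodule.eq_bot_iff]
    exact fun x hx => eq_zero_of_map_mem_nilpotent hA LinearMap.id (fun _ _ => rfl)
      Function.injective_id (Ring.jacobson A) IsSemiprimaryRing.isNilpotent hx
  exact isInnerDerivation_of_isSemisimpleRing h2 hD

end NonUnital

end FinDimAlg

theorem corollary2p3 {F : Type*} {A : Type*} [Field F] [NonUnitalRing A] [Module F A]
    [IsScalarTower F A A] [SMulCommClass F A A] [FiniteDimensional F A]
    (hchar : ringChar F ≠ 2) (hA : FinDimAlg.IsSemisimple F A) (D : A →ₗ[F] A) :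
    (∀ x : A, x * D x * x ∈ FinDimAlg.commutatorSpan F A) ↔
      FinDimAlg.IsInnerDerivation F D := by
  refine ⟨FinDimAlg.isInnerDerivation_of_isSemisimple (Ring.two_ne_zero hchar) hA, ?_⟩
  rintro ⟨a, ha⟩ x
  have h := FinDimAlg.commutator_mem (F := F) (x * a * x) x
  rw [ha]
  convert h using 1
  simp only [mul_sub, sub_mul, mul_assoc]
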